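/- Let $q\in(0,1)$ and let $\gamma\in\mathbb R$ not be a negative integer. For $x\in\mathbb R$ put $[x]_q=\frac{1-q^x}{1-q}$, and $[m]_q!=\prod_{i=1}^m[i]_q$ for $m\in\mathbb N_0=\{0,1,2,\dots\}$. Let $\Gamma_q(t)=\frac{(q,q)_\infty}{(q^t,q)_\infty}(1-q)^{1-t}$ with $(x,q)_\infty=\prod_{j\ge 0}(1-xq^j)$, where $1/\Gamma_q(t)=0$ for $t\in\{0,-1,-2,\dots\}$. For a complex sequence $g=(g_j)_{j\ge 0}$ define $$(\nabla_q^{(\gamma)}g)_j=\sum_{k=0}^{j}(-1)^{j-k}q^{\binom{j-k}{2}}\frac{\Gamma_q(\gamma+1)}{[j-k]_q!\,\Gamma_q(\gamma-j+k+1)}\,g_k ,\qquad j\ge 0,$$ and for $\mathfrak X\in\{\ell_p,\ell_\infty\}$, where $0<p<\infty$, let $\mathfrak X(\nabla_q^{(\gamma)})=\{g:\nabla_q^{(\gamma)}g\in\mathfrak X\}$. The $\beta$-dual $\mathfrak Y^\beta$ of a set $\mathfrak Y$ of complex sequences is the set of all complex sequences $a=(a_j)$ such that the series $\sum_j a_jg_j$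 converges for every $g\in\mathfrak Y$. For a complex sequence $a$ let $$\omega_{jk}=\omega_{jk}(a)=\sum_{v=k}^{j}\frac{[\gamma]_q[\gamma+1]_q\cdots[\gamma+v-k-1]_q}{[v-k]_q!}\,a_v\quad(0\le k\le j),\qquad \omega_{jk}=0\quad(k>j),$$ and define the following sets of complex sequences, where $\frac1p+\frac1{p'}=1$ if $p>1$: $\mathfrak T_1(q)$: all $a$ such that $\lim_{j\to\infty}\omega_{jk}$ exists in $\mathbb C$ for every $k\ge 0$; $\mathfrak T_2(q)$: all $a$ with $\sup_{j}\sum_{k=0}^\infty|\omega_{jk}|^{p'}<\infty$; $\mathfrak T_3(q)$: all $a$ with $\sup_{j,k}|\omega_{jk}|^{p}<\infty$; $\mathfrak T_4(q)$: all $a$ with $\lim_{j\to\infty}\sum_{k=0}^\infty|\omega_{jk}|=\sum_{k=0}^\infty\left|\lim_{j\to\infty}\omega_{jk}\right|$, meaning that all these limits exist and both sides are finite. Then (1) $\{\ell_p(\nabla_q^{(\gamma)})\}^\beta=\mathfrak T_1(q)\cap\mathfrak T_3(q)$ for $0<p\le 1$, and $\{\ell_p(\nabla_q^{(\gamma)})\}^\beta=\mathfrak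 T_1(q)\cap\mathfrak T_2(q)$ for $1<p<\infty$; (2) $\{\ell_\infty(\nabla_q^{(\gamma)})\}^\beta=\mathfrak T_1(q)\cap\mathfrak T_4(q)$. -/

import Mathlib

open Filter Topology

namespace QDiff

noncomputable section

/-- The `q`-number `[x]_q = (1 - q ^ x) / (1 - q)` of a real `x`. For a natural number `x` it is
`1 + q + ... + q ^ (x - 1)`. -/
def qNumber (q x : ℝ) : ℝ := (1 - q ^ x) / (1 - q)

/-- The `q`-factorial `[m]_q! = [1]_q [2]_q ... [m]_q`. -/
def qFactorial (q : ℝ) (m : ℕ) : ℝ := ∏ i ∈ Finset.Icc 1 m, qNumber q (i : ℝ)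

/-- The infinite product `(x, q)_∞ = ∏_{j ≥ 0} (1 - x q ^ j)`. -/
def qPochhammerInf (x q : ℝ) : ℝ := ∏' j : ℕ, (1 - x * q ^ j)

/-- The `q`-gamma function `Γ_q(t) = (q, q)_∞ / (q ^ t, q)_∞ * (1 - q) ^ (1 - t)`, by the same
formula for every real `t` that is not one of the poles `0, -1, -2, ...`. At a pole the value is
`0`, so that dividing by it gives the customary `1 / Γ_q(t) = 0`. -/
def qGamma (q t : ℝ) : ℝ :=
  qPochhammerInf q q / qPochhammerInf (q ^ t) q * (1 - q) ^ (1 - t)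

/-- The coefficient `(-1) ^ m q ^ (m choose 2) Γ_q(γ + 1) / ([m]_q! Γ_q(γ - m + 1))`. -/
def nablaCoeff (q γ : ℝ) (m : ℕ) : ℝ :=
  (-1) ^ m * q ^ (m.choose 2) * qGamma q (γ + 1) / (qFactorial q m * qGamma q (γ - m + 1))

/-- The `q`-difference operator `∇_q^{(γ)}` of order `γ` on complex sequences. -/
def nabla (q γ : ℝ) (g : ℕ → ℂ) : ℕ → ℂ := fun j =>
  ∑ k ∈ Finset.range (j + 1), (nablaCoeff q γ (j - k) : ℂ) * g k

/-- The coefficient `[γ]_q [γ + 1]_q ... [γ + m - 1]_q / [m]_q!` of the inverse operator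
`(∇_q^{(-γ)} g)_j = g_j + [γ]_q g_{j-1} + [γ]_q [γ+1]_q / [2]_q! g_{j-2} + ...`. -/
def nablaInvCoeff (q γ : ℝ) (m : ℕ) : ℝ :=
  (∏ i ∈ Finset.range m, qNumber q (γ + i)) / qFactorial q m

/-- The classical space `ℓ_p` (`0 < p < ∞`) or `ℓ_∞` (`p = ∞`) of complex sequences. -/
def ell (p : ENNReal) : Set (ℕ → ℂ) := {g | Memℓp g p}

/-- The domain `𝔛(∇_q^{(γ)})` of `∇_q^{(γ)}` in a set `𝔛` of sequences. -/
def nablaDomain (q γ : ℝ) (X : Set (ℕ → ℂ)) : Set (ℕ → ℂ) := {g | nabla q γ g ∈ X}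

/-- The space `cs` of sequences whose series converges (not necessarily absolutely). -/
def cs : Set (ℕ → ℂ) :=
  {x | ∃ s : ℂ, Tendsto (fun n => ∑ i ∈ Finset.range (n + 1), x i) atTop (𝓝 s)}

/-- The multiplier space of `X` and `Y`: all `a` with `(a_j g_j) ∈ Y` for every `g ∈ X`. -/
def multiplier (X Y : Set (ℕ → ℂ)) : Set (ℕ → ℂ) :=
  {a | ∀ g ∈ X, (fun j => a j * g j) ∈ Y}

/-- The `β`-dual. -/
def betaDual (X : Set (ℕ → ℂ)) : Set (ℕ → ℂ) := multiplier X cs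

/-- The summation-by-parts triangle `Ω(q)` of a sequence `a`, with the entries
`ω_{jk} = ∑_{v = k}^{j} [γ]_q ... [γ + v - k - 1]_q / [v - k]_q! a_v` for `k ≤ j`
and `ω_{jk} = 0` for `k > j`. -/
def omega (q γ : ℝ) (a : ℕ → ℂ) (j k : ℕ) : ℂ :=
  if k ≤ j then ∑ v ∈ Finset.Icc k j, (nablaInvCoeff q γ (v - k) : ℂ) * a v else 0

/-- `lim_j ω_{jk}` exists for every `k`. -/
def T1 (q γ : ℝ) : Set (ℕ → ℂ) :=
  {a | ∀ k, ∃ l : ℂ, Tendsto (fun j => omega q γ a j k) atTop (𝓝 l)}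

/-- `sup_j ∑_k |ω_{jk}| ^ p' < ∞`, where only the terms with `k ≤ j` can be nonzero. -/
def T2 (q γ p' : ℝ) : Set (ℕ → ℂ) :=
  {a | BddAbove (Set.range fun j => ∑' k, ‖omega q γ a j k‖ ^ p')}

/-- `sup_{j, k} |ω_{jk}| ^ p < ∞`. -/
def T3 (q γ p : ℝ) : Set (ℕ → ℂ) :=
  {a | BddAbove (Set.range fun jk : ℕ × ℕ => ‖omega q γ a jk.1 jk.2‖ ^ p)}

/-- `lim_j ∑_k |ω_{jk}| = ∑_k |lim_j ω_{jk}|`: the limits on the right exist, the series on the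
right converges, and the limit on the left exists and is equal to its sum. -/
def T4 (q γ : ℝ) : Set (ℕ → ℂ) :=
  {a | ∃ l : ℕ → ℂ, (∀ k, Tendsto (fun j => omega q γ a j k) atTop (𝓝 (l k))) ∧
    Summable (fun k => ‖l k‖) ∧
    Tendsto (fun j => ∑' k, ‖omega q γ a j k‖) atTop (𝓝 (∑' k, ‖l k‖))}

end

end QDiff

/-! The coefficients of `∇_q^{(γ)}` and those of its candidate inverse generate q-binomial power
series. First-order q-recurrences make the product `P` of the two series satisfy `P(X) = P(qX)`, so
`P = 1`. Hence `nabla` is a bijection of the space of all sequences (`nabla_nablaInv`,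
`nablaInv_nabla`). Substituting `g = nablaInv f` and summing by parts, `a` lies in the β-dual iff
the triangle `omega` maps `X` into the convergent sequences (`mem_betaDual_nablaDomain_iff`).

From there only the triangularity of `omega` matters, and the classical matrix theorems apply.
Columns converge by testing on unit vectors. For `1 < p < ∞`, Banach–Steinhaus bounds the row
functionals, whose norms are the `ℓ_{p'}` norms of the rows; conversely, bounded rows and convergent
columns suffice by density of finitely supported sequences. For `p ≤ 1` the condition is bounded
entries. For `ℓ_∞`, where density fails, Schur's theorem replaces it: the rows converge in `ℓ₁`,
which amounts to entrywise convergence together with convergence of the `ℓ₁` norms. -/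

namespace QDiff

/-! ### Inverse q-binomial series -/

open PowerSeries in
/-- Two power series with `c₀ = d₀ = 1` whose coefficients satisfy the recurrences of the
`q`-binomial series with parameters `a` and `a⁻¹` (the latter at `a X`) are mutually inverse. -/
theorem mk_mul_mk_eq_one {q a : ℝ} (hq0 : 0 < q) (hq1 : q < 1) {c d : ℕ → ℝ}
    (hc0 : c 0 = 1) (hd0 : d 0 = 1)
    (hc : ∀ n, c (n + 1) * (1 - q ^ (n + 1)) = c n * (1 - a * q ^ n))
    (hd : ∀ n, d (n + 1) * (1 - q ^ (n + 1)) = d n * (a - q ^ n)) :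
    (mk c * mk d : PowerSeries ℝ) = 1 := by
  have hC : (1 - X) * mk c = (1 - C a * X) * rescale q (mk c) := by
    ext n
    rcases n with _ | n
    · simp only [sub_mul, one_mul, mul_assoc, map_sub, coeff_mk, coeff_zero_X_mul, coeff_C_mul,
        coeff_rescale, pow_zero, mul_zero]
    · simp only [sub_mul, one_mul, mul_assoc, map_sub, coeff_mk, coeff_succ_X_mul, coeff_C_mul,
        coeff_rescale]
      linear_combination hc n
  have hD : (1 - C a * X) * mk d = (1 - X) * rescale q (mk d) := by
    ext n
    rcases n with _ | n
    · simp only [sub_mul, one_mul, mul_assoc, map_sub, coeff_mk, coeff_zero_X_mul, coeff_C_mul,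
        coeff_rescale, pow_zero, mul_zero]
    · simp only [sub_mul, one_mul, mul_assoc, map_sub, coeff_mk, coeff_succ_X_mul, coeff_C_mul,
        coeff_rescale]
      linear_combination hd n
  have hne (b : ℝ) : (1 - C b * X : PowerSeries ℝ) ≠ 0 := fun h => by
    simpa using congrArg (coeff 0) h
  -- The factors `1 - X` and `1 - aX` in `hC` and `hD` cross-cancel. Invariance under `X ↦ qX` then
  -- kills every coefficient of positive degree, since `q ^ n ≠ 1`.
  have hP : mk c * mk d = rescale q (mk c * mk d) := by
    have h1 := hne 1
    rw [map_one, one_mul] at h1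
    refine mul_left_cancel₀ (mul_ne_zero h1 (hne a)) ?_
    rw [map_mul]
    linear_combination (1 - C a * X) * mk d * hC + (1 - C a * X) * rescale q (mk c) * hD
  ext n
  rcases n with _ | n
  · simp [hc0, hd0]
  · have h := congrArg (coeff (n + 1)) hP
    rw [coeff_rescale] at h
    have hlt : q ^ (n + 1) < 1 := pow_lt_one₀ hq0.le hq1 (by simp)
    have h0 : (1 - q ^ (n + 1)) * coeff (n + 1) (mk c * mk d) = 0 := by linear_combination h
    rw [(mul_eq_zero.mp h0).resolve_left (by linarith), coeff_one]
    simp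

/-! ### Recurrences for the coefficients of the operator and its inverse -/

theorem qNumber_natCast_succ_ne_zero {q : ℝ} (hq0 : 0 < q) (hq1 : q < 1) (m : ℕ) :
    qNumber q ((m + 1 : ℕ) : ℝ) ≠ 0 := by
  unfold qNumber
  rw [Real.rpow_natCast]
  have hlt : q ^ (m + 1) < 1 := pow_lt_one₀ hq0.le hq1 (by simp)
  exact div_ne_zero (by linarith) (by linarith)

theorem qFactorial_succ (q : ℝ) (m : ℕ) :
    qFactorial q (m + 1) = qFactorial q m * qNumber q ((m + 1 : ℕ) : ℝ) := by
  unfold qFactorial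
  rw [Finset.prod_Icc_succ_top (by simp)]

theorem qFactorial_ne_zero {q : ℝ} (hq0 : 0 < q) (hq1 : q < 1) (m : ℕ) : qFactorial q m ≠ 0 := by
  induction m with
  | zero => simp [qFactorial]
  | succ m ih => rw [qFactorial_succ]; exact mul_ne_zero ih (qNumber_natCast_succ_ne_zero hq0 hq1 m)

theorem nablaInvCoeff_zero (q γ : ℝ) : nablaInvCoeff q γ 0 = 1 := by
  simp [nablaInvCoeff, qFactorial]

theorem nablaInvCoeff_succ {q : ℝ} (γ : ℝ) (hq0 : 0 < q) (hq1 : q < 1) (m : ℕ) :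
    nablaInvCoeff q γ (m + 1) * (1 - q ^ (m + 1)) =
      nablaInvCoeff q γ m * (1 - q ^ γ * q ^ m) := by
  have h1 := qFactorial_ne_zero hq0 hq1 m
  have h2 : q ^ (m + 1) < 1 := pow_lt_one₀ hq0.le hq1 (by simp)
  have h3 : 1 - q ^ (m + 1) ≠ 0 := by linarith
  have h4 : 1 - q ≠ 0 := by linarith
  unfold nablaInvCoeff
  rw [Finset.prod_range_succ, qFactorial_succ]
  unfold qNumber
  rw [Real.rpow_natCast, Real.rpow_add hq0, Real.rpow_natCast]
  field_simp

theorem summable_mul_pow {q : ℝ} (hq0 : 0 < q) (hq1 : q < 1) (x : ℝ) :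
    Summable fun j : ℕ => ‖-(x * q ^ j)‖ := by
  have := (summable_geometric_of_lt_one hq0.le hq1).mul_left ‖x‖
  simpa [abs_of_pos hq0] using this

theorem qPochhammerInf_eq_mul {q : ℝ} (hq0 : 0 < q) (hq1 : q < 1) (x : ℝ) :
    qPochhammerInf x q = (1 - x) * qPochhammerInf (x * q) q := by
  unfold qPochhammerInf
  rw [tprod_eq_zero_mul']
  · simp [pow_succ', mul_assoc]
  · have := multipliable_one_add_of_summable (summable_mul_pow hq0 hq1 (x * q))
    simpa [pow_succ', mul_assoc, sub_eq_add_neg] using this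

theorem qPochhammerInf_ne_zero {q x : ℝ} (hq0 : 0 < q) (hq1 : q < 1)
    (hx : ∀ j : ℕ, x * q ^ j ≠ 1) : qPochhammerInf x q ≠ 0 := by
  have := tprod_one_add_ne_zero_of_summable (f := fun j : ℕ => -(x * q ^ j))
    (fun j h => hx j (by linarith)) (summable_mul_pow hq0 hq1 x)
  simpa [qPochhammerInf, sub_eq_add_neg] using this

theorem qGamma_ne_zero {q t : ℝ} (hq0 : 0 < q) (hq1 : q < 1) (ht : ∀ n : ℕ, t ≠ -(n : ℝ)) :
    qGamma q t ≠ 0 := by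
  unfold qGamma
  refine mul_ne_zero (div_ne_zero ?_ ?_) (Real.rpow_pos_of_pos (by linarith) _).ne'
  · refine qPochhammerInf_ne_zero hq0 hq1 fun j => ?_
    rw [← pow_succ']
    exact (pow_lt_one₀ hq0.le hq1 (by simp)).ne
  · refine qPochhammerInf_ne_zero hq0 hq1 fun j h => ht j ?_
    rw [← Real.rpow_natCast, ← Real.rpow_add hq0] at h
    have := (Real.rpow_right_inj hq0 hq1.ne).mp (h.trans (Real.rpow_zero q).symm)
    linarith

/-- The functional equation of `Γ_q` is stated for reciprocals so that it survives at the poles; `γ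
- m` can be one when `γ` is a natural number. -/
theorem inv_qGamma_eq {q : ℝ} (hq0 : 0 < q) (hq1 : q < 1) (t : ℝ) :
    (qGamma q t)⁻¹ * (1 - q) = (1 - q ^ t) * (qGamma q (t + 1))⁻¹ := by
  have h1 : (1 - q) ^ (1 - t) = (1 - q) ^ (1 - (t + 1)) * (1 - q) := by
    rw [← Real.rpow_add_one (by linarith)]; congr 1; ring
  have h2 : 1 - q ≠ 0 := by linarith
  unfold qGamma
  rw [h1, qPochhammerInf_eq_mul hq0 hq1 (q ^ t), Real.rpow_add_one hq0.ne']
  simp only [mul_inv, div_eq_mul_inv]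
  field_simp

/-- This is where the restriction on `γ` enters: it makes `Γ_q(γ + 1)` nonzero, so that the quotient
really cancels. -/
theorem nablaCoeff_zero {q γ : ℝ} (hq0 : 0 < q) (hq1 : q < 1)
    (hγ : ∀ n : ℕ, γ ≠ -((n : ℝ) + 1)) : nablaCoeff q γ 0 = 1 := by
  have := qGamma_ne_zero hq0 hq1 (t := γ + 1) fun n h => hγ n (by linarith)
  simp [nablaCoeff, qFactorial, this]

theorem nablaCoeff_succ {q : ℝ} (γ : ℝ) (hq0 : 0 < q) (hq1 : q < 1) (m : ℕ) :
    nablaCoeff q γ (m + 1) * (1 - q ^ (m + 1)) = nablaCoeff q γ m * (q ^ γ - q ^ m) := by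
  have h1 := qFactorial_ne_zero hq0 hq1 m
  have h2 : q ^ (m + 1) < 1 := pow_lt_one₀ hq0.le hq1 (by simp)
  have h3 : 1 - q ^ (m + 1) ≠ 0 := by linarith
  have h4 : 1 - q ≠ 0 := by linarith
  have h5 := inv_qGamma_eq hq0 hq1 (γ - m)
  have h6 : γ - ((m + 1 : ℕ) : ℝ) + 1 = γ - m := by push_cast; ring
  have h7 : q ^ γ = q ^ (γ - m) * q ^ m := by
    rw [← Real.rpow_natCast, ← Real.rpow_add hq0]; congr 1; ring
  unfold nablaCoeff
  rw [qFactorial_succ, h6, h7, Nat.choose_succ_succ' m 1, Nat.choose_one_right]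
  unfold qNumber
  rw [Real.rpow_natCast]
  simp only [div_eq_mul_inv, mul_inv, inv_inv]
  field_simp
  linear_combination (-(-1) ^ m * q ^ (m + m.choose 2) * qGamma q (γ + 1)) * h5

theorem mk_nablaInvCoeff_mul_mk_nablaCoeff {q γ : ℝ} (hq0 : 0 < q) (hq1 : q < 1)
    (hγ : ∀ n : ℕ, γ ≠ -((n : ℝ) + 1)) :
    (PowerSeries.mk (nablaInvCoeff q γ) * PowerSeries.mk (nablaCoeff q γ) : PowerSeries ℝ) = 1 :=
  mk_mul_mk_eq_one hq0 hq1 (nablaInvCoeff_zero q γ) (nablaCoeff_zero hq0 hq1 hγ)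
    (nablaInvCoeff_succ γ hq0 hq1) (nablaCoeff_succ γ hq0 hq1)

/-! ### Inversion of the operator and reduction to a triangle -/

/-- The inverse of `∇_q^{(γ)}`. -/
noncomputable def nablaInv (q γ : ℝ) (f : ℕ → ℂ) : ℕ → ℂ := fun j =>
  ∑ k ∈ Finset.range (j + 1), (nablaInvCoeff q γ (j - k) : ℂ) * f k

theorem mk_convolution (c : ℕ → ℝ) (g : ℕ → ℂ) :
    PowerSeries.mk (fun j => ∑ k ∈ Finset.range (j + 1), (c (j - k) : ℂ) * g k) =
      PowerSeries.map Complex.ofRealHom (PowerSeries.mk c) * PowerSeries.mk g := by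
  ext n
  rw [mul_comm, PowerSeries.coeff_mul, Finset.Nat.sum_antidiagonal_eq_sum_range_succ
    (fun i j => PowerSeries.coeff i (PowerSeries.mk g) *
      PowerSeries.coeff j (PowerSeries.map Complex.ofRealHom (PowerSeries.mk c)))]
  simp [mul_comm]

theorem mk_injective {f g : ℕ → ℂ} (h : PowerSeries.mk f = PowerSeries.mk g) : f = g := by
  ext n
  simpa using congrArg (PowerSeries.coeff n) h

theorem nabla_nablaInv {q γ : ℝ} (hq0 : 0 < q) (hq1 : q < 1)
    (hγ : ∀ n : ℕ, γ ≠ -((n : ℝ) + 1)) (f : ℕ → ℂ) : nabla q γ (nablaInv q γ f) = f := by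
  apply mk_injective
  unfold nabla
  rw [mk_convolution]
  unfold nablaInv
  rw [mk_convolution, ← mul_assoc, ← map_mul, mul_comm (PowerSeries.mk (nablaCoeff q γ)),
    mk_nablaInvCoeff_mul_mk_nablaCoeff hq0 hq1 hγ, map_one, one_mul]

theorem nablaInv_nabla {q γ : ℝ} (hq0 : 0 < q) (hq1 : q < 1)
    (hγ : ∀ n : ℕ, γ ≠ -((n : ℝ) + 1)) (g : ℕ → ℂ) : nablaInv q γ (nabla q γ g) = g := by
  apply mk_injective
  unfold nablaInv
  rw [mk_convolution]
  unfold nabla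
  rw [mk_convolution, ← mul_assoc, ← map_mul,
    mk_nablaInvCoeff_mul_mk_nablaCoeff hq0 hq1 hγ, map_one, one_mul]

/-- Summation by parts: partial sums of `a · ∇_q^{(-γ)} f` are given by the triangle `omega`. -/
theorem sum_mul_nablaInv (q γ : ℝ) (a f : ℕ → ℂ) (n : ℕ) :
    ∑ j ∈ Finset.range (n + 1), a j * nablaInv q γ f j =
      ∑ k ∈ Finset.range (n + 1), omega q γ a n k * f k := by
  unfold nablaInv omega
  simp only [Finset.mul_sum]
  rw [Finset.sum_comm' (t' := Finset.range (n + 1)) (s' := fun k => Finset.Icc k n)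
    (by intro x y; simp only [Finset.mem_range, Finset.mem_Icc]; omega)]
  refine Finset.sum_congr rfl fun k hk => ?_
  rw [if_pos (by simpa [Nat.lt_succ_iff] using hk), Finset.sum_mul]
  exact Finset.sum_congr rfl fun v _ => by ring

theorem mem_betaDual_nablaDomain_iff {q γ : ℝ} (hq0 : 0 < q) (hq1 : q < 1)
    (hγ : ∀ n : ℕ, γ ≠ -((n : ℝ) + 1)) (X : Set (ℕ → ℂ)) (a : ℕ → ℂ) :
    a ∈ betaDual (nablaDomain q γ X) ↔ ∀ f ∈ X, ∃ s : ℂ,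
      Tendsto (fun n => ∑ k ∈ Finset.range (n + 1), omega q γ a n k * f k) atTop (𝓝 s) := by
  simp only [← sum_mul_nablaInv]
  constructor
  · intro h f hf
    exact h (nablaInv q γ f) (by simpa [nablaDomain, nabla_nablaInv hq0 hq1 hγ] using hf)
  · intro h g hg
    have := h (nabla q γ g) hg
    rwa [nablaInv_nabla hq0 hq1 hγ] at this

/-! ### Row functionals on `ℓ_p`, `1 ≤ p` -/

/-- The functional `f ↦ ∑_{k ≤ n} r_k f_k` on `ℓ_p`. -/
noncomputable def rowFunctional (p : ENNReal) [Fact (1 ≤ p)] (r : ℕ → ℂ) (n : ℕ) :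
    lp (fun _ : ℕ => ℂ) p →L[ℂ] ℂ :=
  ∑ k ∈ Finset.range (n + 1), r k • lp.evalCLM ℂ (fun _ : ℕ => ℂ) p k

theorem rowFunctional_apply (p : ENNReal) [Fact (1 ≤ p)] (r : ℕ → ℂ) (n : ℕ)
    (f : lp (fun _ : ℕ => ℂ) p) :
    rowFunctional p r n f = ∑ k ∈ Finset.range (n + 1), r k * f k := by
  simp only [rowFunctional, sum_apply, smul_apply,
    smul_eq_mul]
  rfl

/-- The triangle `A` maps `X` into the convergent sequences. -/
def MapsToConvergent (A : ℕ → ℕ → ℂ) (X : Set (ℕ → ℂ)) : Prop :=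
  ∀ f ∈ X, ∃ s : ℂ,
    Tendsto (fun n => ∑ k ∈ Finset.range (n + 1), A n k * f k) atTop (𝓝 s)

theorem sum_range_eq_of_triangular {A : ℕ → ℕ → ℂ} (hA : ∀ n k, n < k → A n k = 0) (f : ℕ → ℂ)
    {n R : ℕ} (hR : n + 1 ≤ R) :
    ∑ k ∈ Finset.range (n + 1), A n k * f k = ∑ k ∈ Finset.range R, A n k * f k := by
  refine Finset.sum_subset (Finset.range_subset_range.mpr hR) fun k _ hk => ?_
  rw [hA n k (by simpa using hk), zero_mul]

theorem sum_mul_single {A : ℕ → ℕ → ℂ} (hA : ∀ n k, n < k → A n k = 0) (n k : ℕ) (c : ℂ) :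
    ∑ i ∈ Finset.range (n + 1), A n i * (Pi.single k c : ℕ → ℂ) i = A n k * c := by
  rw [sum_range_eq_of_triangular hA _ (le_max_left (n + 1) (k + 1)), Finset.sum_eq_single k]
  · simp
  · intro b _ hb; simp [hb]
  · intro hk; exact absurd (Finset.mem_range.mpr (by omega)) hk

theorem MapsToConvergent.column {A : ℕ → ℕ → ℂ} (hA : ∀ n k, n < k → A n k = 0) {p : ENNReal}
    (h : MapsToConvergent A (ell p)) (k : ℕ) :
    ∃ l : ℂ, Tendsto (fun n => A n k) atTop (𝓝 l) := by
  obtain ⟨s, hs⟩ := h (Pi.single k 1)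
    (lp.single (E := fun _ : ℕ => ℂ) p k (1 : ℂ)).2
  refine ⟨s, ?_⟩
  simpa [sum_mul_single hA] using hs

theorem MapsToConvergent.exists_norm_rowFunctional_le {A : ℕ → ℕ → ℂ} {p : ENNReal}
    [Fact (1 ≤ p)] (h : MapsToConvergent A (ell p)) :
    ∃ C, ∀ n, ‖rowFunctional p (A n) n‖ ≤ C := by
  refine banach_steinhaus fun f => ?_
  obtain ⟨s, hs⟩ := h f f.2
  obtain ⟨C, hC⟩ := hs.norm.bddAbove_range
  exact ⟨C, fun n => by rw [rowFunctional_apply]; exact hC ⟨n, rfl⟩⟩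

/-- An ε/3 argument: equicontinuity carries the Cauchy property to limits. The constant `C + 1`
avoids dividing by zero when `C = 0`. -/
theorem cauchySeq_apply_of_tendsto {ι E : Type*} [NormedAddCommGroup E] [NormedSpace ℂ E]
    {φ : ℕ → E →L[ℂ] ℂ} {C : ℝ} (hC : ∀ n, ‖φ n‖ ≤ C) {F : Filter ι} [F.NeBot] {u : ι → E}
    {x : E} (hu : Tendsto u F (𝓝 x)) (hφ : ∀ i, CauchySeq fun n => φ n (u i)) :
    CauchySeq fun n => φ n x := by
  rw [Metric.cauchySeq_iff']
  intro ε hε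
  have hC0 : 0 ≤ C := (norm_nonneg _).trans (hC 0)
  obtain ⟨i, hi⟩ := (Metric.tendsto_nhds.mp hu (ε / (3 * (C + 1))) (by positivity)).exists
  have hle (n : ℕ) : dist (φ n x) (φ n (u i)) ≤ ε / 3 := by
    rw [dist_comm, dist_eq_norm, ← map_sub]
    calc ‖φ n (u i - x)‖ ≤ C * ‖u i - x‖ := (φ n).le_of_opNorm_le (hC n) _
      _ ≤ (C + 1) * (ε / (3 * (C + 1))) := by
        rw [← dist_eq_norm]
        exact mul_le_mul (by linarith) hi.le dist_nonneg (by linarith)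
      _ = ε / 3 := by field_simp
  obtain ⟨N, hN⟩ := Metric.cauchySeq_iff'.mp (hφ i) (ε / 3) (by positivity)
  refine ⟨N, fun n hn => ?_⟩
  have h1 := dist_triangle4 (φ n x) (φ n (u i)) (φ N (u i)) (φ N x)
  have h2 := hN n hn
  have h3 := hle N
  rw [dist_comm] at h3
  linarith [hle n]

/-- On finitely supported sequences convergence follows from that of the columns; for `p ≠ ⊤` these
are dense. -/
theorem mapsToConvergent_of_norm_rowFunctional_le {A : ℕ → ℕ → ℂ}
    (hA : ∀ n k, n < k → A n k = 0) {p : ENNReal} [Fact (1 ≤ p)] (hp : p ≠ ⊤) {C : ℝ}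
    (hC : ∀ n, ‖rowFunctional p (A n) n‖ ≤ C)
    (hcol : ∀ k, ∃ l : ℂ, Tendsto (fun n => A n k) atTop (𝓝 l)) :
    MapsToConvergent A (ell p) := by
  intro f hf
  have hsum := lp.hasSum_single (E := fun _ : ℕ => ℂ) hp ⟨f, hf⟩
  have := cauchySeq_apply_of_tendsto hC hsum fun s => ?_
  · obtain ⟨l, hl⟩ := cauchySeq_tendsto_of_complete this
    exact ⟨l, by simpa only [rowFunctional_apply] using hl⟩
  · choose l hl using hcol
    have : Tendsto (fun n => ∑ k ∈ s, A n k * f k) atTop (𝓝 (∑ k ∈ s, l k * f k)) :=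
      tendsto_finsetSum _ fun k _ => (hl k).mul_const _
    refine Tendsto.cauchySeq (x := ∑ k ∈ s, l k * f k) ?_
    refine this.congr fun n => ?_
    rw [map_sum]
    refine Finset.sum_congr rfl fun k _ => ?_
    rw [rowFunctional_apply, ← sum_mul_single hA n k (f k)]
    rfl

theorem norm_rowFunctional_le_of_sum_rpow_le {p p' : ℝ} (hpp : p.HolderConjugate p')
    [Fact (1 ≤ ENNReal.ofReal p)] {r : ℕ → ℂ} {n : ℕ} {C : ℝ} (hC : 0 ≤ C)
    (h : ∑ k ∈ Finset.range (n + 1), ‖r k‖ ^ p' ≤ C) :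
    ‖rowFunctional (ENNReal.ofReal p) r n‖ ≤ C ^ (1 / p') := by
  refine ContinuousLinearMap.opNorm_le_bound _ (by positivity) fun f => ?_
  have hp := hpp.pos
  have hp' := hpp.symm.pos
  have hpr : (ENNReal.ofReal p).toReal = p := ENNReal.toReal_ofReal hp.le
  have h2 := lp.sum_rpow_le_norm_rpow (p := ENNReal.ofReal p) (by rwa [hpr]) f
    (Finset.range (n + 1))
  rw [hpr] at h2
  rw [rowFunctional_apply]
  calc ‖∑ k ∈ Finset.range (n + 1), r k * f k‖
      ≤ ∑ k ∈ Finset.range (n + 1), ‖r k‖ * ‖f k‖ :=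
        (norm_sum_le _ _).trans_eq (by simp only [norm_mul])
    _ ≤ (∑ k ∈ Finset.range (n + 1), ‖r k‖ ^ p') ^ (1 / p') *
        (∑ k ∈ Finset.range (n + 1), ‖f k‖ ^ p) ^ (1 / p) :=
        Real.inner_le_Lp_mul_Lq_of_nonneg _ hpp.symm (fun _ _ => norm_nonneg _)
          fun _ _ => norm_nonneg _
    _ ≤ C ^ (1 / p') * (‖f‖ ^ p) ^ (1 / p) := by gcongr
    _ = C ^ (1 / p') * ‖f‖ := by
        rw [one_div p, Real.rpow_rpow_inv (norm_nonneg _) hp.ne']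

/-- Converse of Hölder, by its equality case: testing on `conj(r_k)/|r_k| * |r_k|^(p'-1)` gives `S ≤
C * S^(1/p)`, and `S^(1/p)` is cancelled. -/
theorem sum_rpow_le_of_norm_rowFunctional_le {p p' : ℝ} (hpp : p.HolderConjugate p')
    [Fact (1 ≤ ENNReal.ofReal p)] {r : ℕ → ℂ} {n : ℕ} {C : ℝ}
    (h : ‖rowFunctional (ENNReal.ofReal p) r n‖ ≤ C) :
    ∑ k ∈ Finset.range (n + 1), ‖r k‖ ^ p' ≤ C ^ p' := by
  have hp := hpp.pos
  have hp' := hpp.symm.pos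
  have hC : 0 ≤ C := (norm_nonneg _).trans h
  have hpr : (ENNReal.ofReal p).toReal = p := ENNReal.toReal_ofReal hp.le
  set S := ∑ k ∈ Finset.range (n + 1), ‖r k‖ ^ p' with hS
  have hS0 : 0 ≤ S := Finset.sum_nonneg fun _ _ => by positivity
  let f : ℕ → ℂ := fun k =>
    (starRingEnd ℂ) (r k) / (‖r k‖ : ℂ) * ((‖r k‖ ^ (p' - 1) : ℝ) : ℂ)
  have hrf (k : ℕ) : r k * f k = ((‖r k‖ ^ p' : ℝ) : ℂ) := by
    by_cases hr : r k = 0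
    · simp [f, hr, Real.zero_rpow hp'.ne']
    · have hr' : ‖r k‖ ≠ 0 := norm_ne_zero_iff.mpr hr
      have hrc : (‖r k‖ : ℂ) ≠ 0 := by exact_mod_cast hr'
      simp only [f]
      rw [Real.rpow_sub_one hr', ← mul_assoc, ← mul_div_assoc, Complex.mul_conj,
        Complex.normSq_eq_norm_sq]
      push_cast
      field_simp
  have hfp (k : ℕ) : ‖f k‖ ^ p = ‖r k‖ ^ p' := by
    by_cases hr : r k = 0
    · simp [f, hr, Real.zero_rpow hp'.ne', Real.zero_rpow hp.ne']
    · have hr' : ‖r k‖ ≠ 0 := norm_ne_zero_iff.mpr hr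
      have : ‖f k‖ = ‖r k‖ ^ (p' - 1) := by
        simp only [f, norm_mul, norm_div, RCLike.norm_conj, Complex.norm_real, norm_norm]
        rw [div_self hr', one_mul, Real.norm_of_nonneg (by positivity)]
      rw [this, ← Real.rpow_mul (norm_nonneg _), hpp.symm.sub_one_mul_conj]
  let x : lp (fun _ : ℕ => ℂ) (ENNReal.ofReal p) :=
    ∑ k ∈ Finset.range (n + 1), lp.single (ENNReal.ofReal p) k (f k)
  have hx : ‖x‖ ^ p = S := by
    have := lp.norm_sum_single (p := ENNReal.ofReal p) (E := fun _ : ℕ => ℂ) (by rwa [hpr]) f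
      (Finset.range (n + 1))
    rw [hpr] at this
    rw [this, hS]
    exact Finset.sum_congr rfl fun k _ => hfp k
  have hφ : rowFunctional (ENNReal.ofReal p) r n x = (S : ℂ) := by
    rw [rowFunctional_apply, hS, Complex.ofReal_sum]
    refine Finset.sum_congr rfl fun k hk => ?_
    rw [← hrf k]
    congr 1
    change lp.evalCLM ℂ (fun _ : ℕ => ℂ) (ENNReal.ofReal p) k x = f k
    rw [map_sum, Finset.sum_eq_single k]
    · exact lp.single_apply_self (E := fun _ : ℕ => ℂ) (ENNReal.ofReal p) k (f k)
    · intro b _ hb; exact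
        lp.single_apply_ne (E := fun _ : ℕ => ℂ) (ENNReal.ofReal p) b (f b) hb.symm
    · intro h; exact absurd hk h
  have hle : S ≤ C * S ^ (1 / p) := by
    have := (rowFunctional (ENNReal.ofReal p) r n).le_of_opNorm_le h x
    rw [hφ, Complex.norm_real, Real.norm_of_nonneg hS0] at this
    rwa [← hx, one_div, Real.rpow_rpow_inv (norm_nonneg _) hp.ne', hx]
  rcases hS0.eq_or_lt with h0 | h0
  · rw [← h0]; positivity
  · have hpow : S ^ (1 / p') * S ^ (1 / p) = S := by
      rw [← Real.rpow_add h0, one_div, one_div, hpp.symm.inv_add_inv_eq_one, Real.rpow_one]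
    have : S ^ (1 / p') ≤ C :=
      le_of_mul_le_mul_right (hpow.trans_le hle) (Real.rpow_pos_of_pos h0 _)
    calc S = (S ^ (1 / p')) ^ p' := by rw [one_div, Real.rpow_inv_rpow hS0 hp'.ne']
      _ ≤ C ^ p' := by gcongr

theorem norm_le_of_norm_rowFunctional_le {p : ENNReal} [Fact (1 ≤ p)] {A : ℕ → ℕ → ℂ}
    (hA : ∀ n k, n < k → A n k = 0) {C : ℝ} {n : ℕ}
    (h : ‖rowFunctional p (A n) n‖ ≤ C) (k : ℕ) : ‖A n k‖ ≤ C := by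
  have hp : 0 < p := zero_lt_one.trans_le Fact.out
  have := (rowFunctional p (A n) n).le_of_opNorm_le h (lp.single p k (1 : ℂ))
  rw [lp.norm_single hp, rowFunctional_apply, lp.coeFn_single, sum_mul_single hA] at this
  simpa using this

theorem norm_rowFunctional_one_le {r : ℕ → ℂ} {n : ℕ} {C : ℝ} (hC : ∀ k, ‖r k‖ ≤ C) :
    ‖rowFunctional 1 r n‖ ≤ C := by
  have hC0 : 0 ≤ C := (norm_nonneg _).trans (hC 0)
  refine ContinuousLinearMap.opNorm_le_bound _ hC0 fun f => ?_
  have h := lp.sum_rpow_le_norm_rpow (p := 1) (by simp) f (Finset.range (n + 1))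
  simp only [ENNReal.toReal_one, Real.rpow_one] at h
  rw [rowFunctional_apply]
  calc ‖∑ k ∈ Finset.range (n + 1), r k * f k‖
      ≤ ∑ k ∈ Finset.range (n + 1), ‖r k‖ * ‖f k‖ :=
        (norm_sum_le _ _).trans_eq (by simp only [norm_mul])
    _ ≤ ∑ k ∈ Finset.range (n + 1), C * ‖f k‖ := by gcongr; exact hC _
    _ ≤ C * ‖f‖ := by rw [← Finset.mul_sum]; gcongr

/-! ### Bounded entries for small exponents -/

/-- For `0 < p ≤ 1` boundedness of the entries is deduced from the case `p = 1` applied to a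
suitably weighted subsequence of the columns. -/
theorem MapsToConvergent.exists_norm_le {A : ℕ → ℕ → ℂ} (hA : ∀ n k, n < k → A n k = 0) {p : ℝ}
    (hp : 0 < p) (h : MapsToConvergent A (ell (ENNReal.ofReal p))) :
    ∃ C, ∀ n k, ‖A n k‖ ≤ C := by
  have hpr : (ENNReal.ofReal p).toReal = p := ENNReal.toReal_ofReal hp.le
  have hcol (k : ℕ) : ∃ C, ∀ n, ‖A n k‖ ≤ C := by
    obtain ⟨l, hl⟩ := h.column hA k
    obtain ⟨C, hC⟩ := hl.norm.bddAbove_range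
    exact ⟨C, fun n => hC ⟨n, rfl⟩⟩
  choose D hD using hcol
  by_contra! hunb
  -- The weights satisfy `∑ w_i ^ p < ∞`, so a bounded sequence times `w` lies in `ℓ_p`, even where
  -- `ℓ_p` is not normed.
  let w : ℕ → ℝ := fun i => ((1 / 2 : ℝ) ^ i) ^ (1 / p)
  have hw0 (i : ℕ) : 0 < w i := by positivity
  have hwp (i : ℕ) : w i ^ p = (1 / 2 : ℝ) ^ i := by
    simp only [w]
    rw [one_div p, Real.rpow_inv_rpow (by positivity) hp.ne']
  have hfreq (i : ℕ) : ∃ᶠ k in atTop, ∃ n, (i : ℝ) < ‖A n k‖ * w i := by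
    rw [frequently_atTop]
    intro K
    -- The first summand makes the weighted entry exceed `i`; the second exceeds the bounds of the
    -- first `K` columns and so forces `k ≥ K`.
    obtain ⟨n, k, hnk⟩ := hunb (i / w i + ∑ j ∈ Finset.range K, |D j|)
    refine ⟨k, ?_, n, ?_⟩
    · by_contra! hk
      have h1 : |D k| ≤ ∑ j ∈ Finset.range K, |D j| :=
        Finset.single_le_sum (f := fun j => |D j|) (fun _ _ => abs_nonneg _)
          (Finset.mem_range.mpr hk)
      have h2 : 0 ≤ i / w i := div_nonneg i.cast_nonneg (hw0 i).le
      linarith [hD k n, le_abs_self (D k)]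
    · rw [← div_lt_iff₀ (hw0 i)]
      have : 0 ≤ ∑ j ∈ Finset.range K, |D j| := Finset.sum_nonneg fun _ _ => abs_nonneg _
      linarith
  obtain ⟨φ, hφ, hbig⟩ := extraction_forall_of_frequently hfreq
  have hB0 : ∀ n i, n < i → A n (φ i) * (w i : ℂ) = 0 := fun n i hi => by
    rw [hA n (φ i) (hi.trans_le (hφ.id_le i)), zero_mul]
  have hB : MapsToConvergent (fun n i => A n (φ i) * (w i : ℂ)) (ell 1) := by
    intro g hg
    let f : ℕ → ℂ := Function.extend φ (fun i => (w i : ℂ) * g i) 0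
    have hfφ (i : ℕ) : f (φ i) = (w i : ℂ) * g i := hφ.injective.extend_apply _ _ i
    have hf0 (k : ℕ) (hk : k ∉ Set.range φ) : f k = 0 :=
      Function.extend_apply' _ _ _ fun ⟨i, hi⟩ => hk ⟨i, hi⟩
    have hf : f ∈ ell (ENNReal.ofReal p) := by
      refine memℓp_gen ?_
      rw [hpr, ← hφ.injective.summable_iff]
      · obtain ⟨H, hH⟩ := memℓp_infty_iff.mp (hg.of_exponent_ge le_top)
        refine Summable.of_nonneg_of_le (fun i => Real.rpow_nonneg (norm_nonneg _) _)
          (fun i => ?_)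
          (summable_geometric_two.mul_right (H ^ p))
        have hgi : ‖g i‖ ≤ H := hH ⟨i, rfl⟩
        simp only [Function.comp_apply, hfφ, norm_mul, Complex.norm_real]
        rw [Real.norm_of_nonneg (hw0 i).le, Real.mul_rpow (hw0 i).le (norm_nonneg _), hwp]
        gcongr
      · intro k hk
        rw [hf0 k hk, norm_zero, Real.zero_rpow hp.ne']
    obtain ⟨s, hs⟩ := h f hf
    refine ⟨s, hs.congr fun n => ?_⟩
    -- Passing through `tsum` allows reindexing along `φ`, although the two finite ranges do not
    -- correspond.
    have h1 : ∑' k, A n k * f k = ∑ k ∈ Finset.range (n + 1), A n k * f k :=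
      tsum_eq_sum fun k hk => by rw [hA n k (by simpa using hk), zero_mul]
    have h2 : ∑' i, A n (φ i) * f (φ i) =
        ∑ i ∈ Finset.range (n + 1), A n (φ i) * f (φ i) :=
      tsum_eq_sum fun i hi => by
        rw [hA n (φ i) ((by simpa using hi : n < i).trans_le (hφ.id_le i)), zero_mul]
    have h3 : ∑' i, A n (φ i) * f (φ i) = ∑' k, A n k * f k :=
      hφ.injective.tsum_eq (f := fun k => A n k * f k) fun k hk => by
        by_contra hk'
        exact hk (by simp [hf0 k hk'])
    rw [← h1, ← h3, h2]
    exact Finset.sum_congr rfl fun i _ => by rw [hfφ, mul_assoc]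
  obtain ⟨C, hC⟩ := hB.exists_norm_rowFunctional_le
  obtain ⟨i, hi⟩ := exists_nat_gt C
  obtain ⟨n, hn⟩ := hbig i
  have := norm_le_of_norm_rowFunctional_le hB0 (hC n) i
  rw [norm_mul, Complex.norm_real, Real.norm_of_nonneg (hw0 i).le] at this
  linarith

/-! ### Schur's theorem for bounded sequences -/

open Metric in
/-- Baire's theorem on the product of the unit discs gives uniformly small tails for a triangle
that maps bounded sequences to convergent ones. -/
theorem MapsToConvergent.exists_sum_Ico_norm_sub_le {A : ℕ → ℕ → ℂ}
    (hA : ∀ n k, n < k → A n k = 0) (h : MapsToConvergent A (ell ⊤)) {ε : ℝ} (hε : 0 < ε) :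
    ∃ K N, ∀ n ≥ N, ∀ m ≥ N, ∀ M, ∑ k ∈ Finset.Ico K M, ‖A n k - A m k‖ ≤ ε := by
  let φ : ℕ → (ℕ → closedBall (0 : ℂ) 1) → ℂ := fun n f =>
    ∑ k ∈ Finset.range (n + 1), A n k * (f k : ℂ)
  have hφ (n : ℕ) : Continuous (φ n) := by fun_prop
  let F : ℕ → Set (ℕ → closedBall (0 : ℂ) 1) := fun N =>
    {f | ∀ n ≥ N, ∀ m ≥ N, ‖φ n f - φ m f‖ ≤ ε}
  have hF (N : ℕ) : IsClosed (F N) := by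
    simp only [F, Set.ofPred_forall]
    exact isClosed_iInter fun n => isClosed_iInter fun _ => isClosed_iInter fun m =>
      isClosed_iInter fun _ => isClosed_le ((hφ n).sub (hφ m)).norm continuous_const
  have hU : ⋃ N, F N = Set.univ := by
    refine Set.eq_univ_of_forall fun f => Set.mem_iUnion.mpr ?_
    have hf : (fun k => (f k : ℂ)) ∈ ell ⊤ := by
      refine memℓp_infty ⟨1, ?_⟩
      rintro _ ⟨k, rfl⟩
      exact mem_closedBall_zero_iff.mp (f k).2
    obtain ⟨s, hs⟩ := h _ hf
    obtain ⟨N, hN⟩ := Metric.cauchySeq_iff.mp hs.cauchySeq ε hε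
    exact ⟨N, fun n hn m hm => by rw [← dist_eq_norm]; exact (hN n hn m hm).le⟩
  obtain ⟨N, f₀, hf₀⟩ := nonempty_interior_of_iUnion_of_closed hF hU
  -- A basic open set of the product topology constrains only the coordinates in `I`; all those from
  -- `K` on are free.
  obtain ⟨I, u, hu, hIu⟩ := isOpen_pi_iff.mp isOpen_interior f₀ hf₀
  refine ⟨I.sup id + 1, N, fun n hn m hm M => ?_⟩
  set K := I.sup id + 1
  let d : ℕ → ℂ := fun k => A n k - A m k
  let σ : ℕ → ℂ := fun k => (starRingEnd ℂ) (d k) / (‖d k‖ : ℂ)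
  have hσ1 (k : ℕ) : ‖σ k‖ ≤ 1 := by
    simp only [σ, norm_div, RCLike.norm_conj, Complex.norm_real, norm_norm]
    exact div_self_le_one _
  have hσ (k : ℕ) : d k * σ k = (‖d k‖ : ℂ) := by
    by_cases hd : d k = 0
    · simp [hd]
    · have : (‖d k‖ : ℂ) ≠ 0 := by simpa using hd
      simp only [σ]
      rw [← mul_div_assoc, Complex.mul_conj, Complex.normSq_eq_norm_sq]
      push_cast
      field_simp
  -- For `c = 1` and `c = -1` the point stays in `F N`. Subtracting the two estimates cancels `f₀`
  -- and leaves twice the wanted sum, bounded by `2ε`.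
  let g (c : ℂ) (hc : ‖c‖ = 1) : ℕ → closedBall (0 : ℂ) 1 := fun k =>
    if k ∈ Finset.Ico K M then ⟨c * σ k, by simpa [hc] using hσ1 k⟩ else f₀ k
  have hg (c : ℂ) (hc : ‖c‖ = 1) : ‖φ n (g c hc) - φ m (g c hc)‖ ≤ ε := by
    refine interior_subset (hIu ?_ : g c hc ∈ interior (F N)) n hn m hm
    intro i hi
    have : g c hc i = f₀ i := if_neg fun h => by
      have h1 : i ≤ I.sup id := Finset.le_sup (f := id) hi
      have h2 := (Finset.mem_Ico.mp h).1
      omega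
    rw [this]
    exact (hu i hi).2
  let R := max (max (n + 1) (m + 1)) M
  have hφR (f : ℕ → closedBall (0 : ℂ) 1) :
      φ n f - φ m f = ∑ k ∈ Finset.range R, d k * (f k : ℂ) := by
    simp only [φ]
    rw [sum_range_eq_of_triangular hA (fun k => (f k : ℂ)) (R := R) (by omega),
      sum_range_eq_of_triangular hA (fun k => (f k : ℂ)) (R := R) (by omega),
      ← Finset.sum_sub_distrib]
    exact Finset.sum_congr rfl fun k _ => (sub_mul _ _ _).symm
  have h1 : ‖(1 : ℂ)‖ = 1 := by simp
  have h2 : ‖(-1 : ℂ)‖ = 1 := by simp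
  have hdiff : (φ n (g 1 h1) - φ m (g 1 h1)) - (φ n (g (-1) h2) - φ m (g (-1) h2)) =
      ((2 * ∑ k ∈ Finset.Ico K M, ‖d k‖ : ℝ) : ℂ) := by
    rw [hφR, hφR, ← Finset.sum_sub_distrib,
      ← Finset.sum_subset (s₁ := Finset.Ico K M) (fun k hk => by
        have := (Finset.mem_Ico.mp hk).2
        exact Finset.mem_range.mpr (by omega))
        (fun k _ hk => by simp only [g, if_neg hk, sub_self])]
    push_cast
    rw [Finset.mul_sum]
    refine Finset.sum_congr rfl fun k hk => ?_
    simp only [g, if_pos hk]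
    linear_combination 2 * hσ k
  have hle := (norm_sub_le _ _).trans (add_le_add (hg 1 h1) (hg (-1) h2))
  rw [hdiff, Complex.norm_real, Real.norm_eq_abs] at hle
  linarith [le_abs_self (2 * ∑ k ∈ Finset.Ico K M, ‖d k‖)]

theorem sum_range_le_add_of_sum_Ico_le {u : ℕ → ℝ} (hu : ∀ k, 0 ≤ u k) {K M : ℕ} {ε : ℝ}
    (h : ∑ k ∈ Finset.Ico K M, u k ≤ ε) :
    ∑ k ∈ Finset.range M, u k ≤ ∑ k ∈ Finset.range K, u k + ε := by
  rcases le_total K M with hKM | hKM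
  · rw [← Finset.sum_range_add_sum_Ico _ hKM]
    linarith
  · have := Finset.sum_le_sum_of_subset_of_nonneg (Finset.range_subset_range.mpr hKM)
      fun k _ _ => hu k
    have h0 : 0 ≤ ∑ k ∈ Finset.Ico K M, u k := Finset.sum_nonneg fun k _ => hu k
    linarith

theorem summable_norm_of_triangular {A : ℕ → ℕ → ℂ} (hA : ∀ n k, n < k → A n k = 0) (n : ℕ) :
    Summable fun k => ‖A n k‖ :=
  summable_of_ne_finset_zero (s := Finset.range (n + 1)) fun k hk => by
    rw [hA n k (by simpa using hk), norm_zero]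

/-- Letting `m → ∞` in the uniform tail estimate bounds the tails of `A n - l`; the finitely many
remaining columns converge, so `A n → l` in `ℓ₁`. -/
theorem MapsToConvergent.summable_and_tendsto_tsum_norm {A : ℕ → ℕ → ℂ}
    (hA : ∀ n k, n < k → A n k = 0) (h : MapsToConvergent A (ell ⊤)) {l : ℕ → ℂ}
    (hl : ∀ k, Tendsto (fun n => A n k) atTop (𝓝 (l k))) :
    Summable (fun k => ‖l k‖) ∧
      Tendsto (fun n => ∑' k, ‖A n k‖) atTop (𝓝 (∑' k, ‖l k‖)) := by
  have htail {ε : ℝ} (hε : 0 < ε) : ∃ K N, ∀ n ≥ N, ∀ M,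
      ∑ k ∈ Finset.range M, ‖A n k - l k‖ ≤
        ∑ k ∈ Finset.range K, ‖A n k - l k‖ + ε := by
    obtain ⟨K, N, hKN⟩ := h.exists_sum_Ico_norm_sub_le hA hε
    refine ⟨K, N, fun n hn M => sum_range_le_add_of_sum_Ico_le (fun _ => norm_nonneg _) ?_⟩
    have ht : Tendsto (fun m => ∑ k ∈ Finset.Ico K M, ‖A n k - A m k‖) atTop
        (𝓝 (∑ k ∈ Finset.Ico K M, ‖A n k - l k‖)) :=
      tendsto_finsetSum _ fun k _ => ((hl k).const_sub (A n k)).norm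
    exact le_of_tendsto ht (eventually_atTop.mpr ⟨N, fun m hm => hKN n hn m hm M⟩)
  have hs : Summable fun k => ‖l k‖ := by
    obtain ⟨K, N, hKN⟩ := htail one_pos
    have hd : Summable fun k => ‖A N k - l k‖ :=
      summable_of_sum_range_le (fun _ => norm_nonneg _) (hKN N le_rfl)
    refine Summable.of_nonneg_of_le (fun _ => norm_nonneg _) (fun k => ?_)
      ((summable_norm_of_triangular hA N).add hd)
    calc ‖l k‖ = ‖A N k - (A N k - l k)‖ := by rw [sub_sub_cancel]
      _ ≤ _ := norm_sub_le _ _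
  refine ⟨hs, ?_⟩
  rw [tendsto_iff_norm_sub_tendsto_zero]
  have hsA := summable_norm_of_triangular hA
  have hsd (n : ℕ) : Summable fun k => ‖A n k - l k‖ :=
    Summable.of_nonneg_of_le (fun _ => norm_nonneg _) (fun k => norm_sub_le _ _) ((hsA n).add hs)
  have hle (n : ℕ) : ‖∑' k, ‖A n k‖ - ∑' k, ‖l k‖‖ ≤ ∑' k, ‖A n k - l k‖ := by
    rw [← (hsA n).tsum_sub hs]
    exact tsum_of_norm_bounded (hsd n).hasSum fun k => abs_norm_sub_norm_le _ _
  refine squeeze_zero (fun _ => norm_nonneg _) hle ?_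
  rw [Metric.tendsto_atTop]
  intro ε hε
  obtain ⟨K, N, hKN⟩ := htail (half_pos hε)
  have ht : Tendsto (fun n => ∑ k ∈ Finset.range K, ‖A n k - l k‖) atTop (𝓝 0) := by
    simpa using tendsto_finsetSum (Finset.range K) fun k _ => ((hl k).sub_const (l k)).norm
  obtain ⟨N', hN'⟩ := eventually_atTop.mp (ht.eventually_lt_const (half_pos hε))
  refine ⟨max N N', fun n hn => ?_⟩
  rw [Real.dist_0_eq_abs, abs_of_nonneg (tsum_nonneg fun _ => norm_nonneg _)]
  have h1 := (hsd n).tsum_le_of_sum_range_le (hKN n (le_of_max_le_left hn))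
  have h2 := hN' n (le_of_max_le_right hn)
  linarith

/-- If `A n → l` entrywise and in total mass, then `A n → l` in `ℓ₁`. -/
theorem tendsto_tsum_norm_sub {A : ℕ → ℕ → ℂ} (hsA : ∀ n, Summable fun k => ‖A n k‖)
    {l : ℕ → ℂ} (hl : ∀ k, Tendsto (fun n => A n k) atTop (𝓝 (l k)))
    (hs : Summable fun k => ‖l k‖)
    (ht : Tendsto (fun n => ∑' k, ‖A n k‖) atTop (𝓝 (∑' k, ‖l k‖))) :
    Tendsto (fun n => ∑' k, ‖A n k - l k‖) atTop (𝓝 0) := by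
  have hsd (n : ℕ) : Summable fun k => ‖A n k - l k‖ :=
    Summable.of_nonneg_of_le (fun _ => norm_nonneg _) (fun k => norm_sub_le _ _) ((hsA n).add hs)
  -- Scheffé's trick: these terms lie between `0` and `2‖l k‖`, so dominated convergence applies
  -- without a bound on `A n`.
  have hdom : Tendsto (fun n => ∑' k, (‖l k‖ + ‖A n k - l k‖ - ‖A n k‖)) atTop
      (𝓝 (∑' _ : ℕ, (0 : ℝ))) := by
    refine tendsto_tsum_of_dominated_convergence (hs.mul_left 2) (fun k => ?_)
      (Eventually.of_forall fun n k => ?_)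
    · have := (((hl k).sub_const (l k)).norm.const_add ‖l k‖).sub (hl k).norm
      simpa using this
    · have h1 : ‖A n k‖ ≤ ‖l k‖ + ‖A n k - l k‖ := by
        simpa using norm_add_le (l k) (A n k - l k)
      have h2 := norm_sub_le (A n k) (l k)
      rw [Real.norm_of_nonneg (by linarith)]
      linarith
  have := (hdom.add ht).sub_const (∑' k, ‖l k‖)
  rw [tsum_zero, zero_add, sub_self] at this
  refine this.congr fun n => ?_
  rw [(hs.add (hsd n)).tsum_sub (hsA n), hs.tsum_add (hsd n)]
  ring

/-- The limit is `∑ l_k f_k`; the error is at most `sup |f|` times the `ℓ₁` distance from `A n` to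
`l`. -/
theorem mapsToConvergent_ell_top {A : ℕ → ℕ → ℂ} (hA : ∀ n k, n < k → A n k = 0) {l : ℕ → ℂ}
    (hl : ∀ k, Tendsto (fun n => A n k) atTop (𝓝 (l k))) (hs : Summable fun k => ‖l k‖)
    (ht : Tendsto (fun n => ∑' k, ‖A n k‖) atTop (𝓝 (∑' k, ‖l k‖))) :
    MapsToConvergent A (ell ⊤) := by
  intro f hf
  obtain ⟨H, hH⟩ := memℓp_infty_iff.mp hf
  have hfH (k : ℕ) : ‖f k‖ ≤ H := hH ⟨k, rfl⟩
  have hsA := summable_norm_of_triangular hA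
  have hsd (n : ℕ) : Summable fun k => ‖A n k - l k‖ :=
    Summable.of_nonneg_of_le (fun _ => norm_nonneg _) (fun k => norm_sub_le _ _) ((hsA n).add hs)
  have hmul {r : ℕ → ℂ} (hr : Summable fun k => ‖r k‖) : Summable fun k => r k * f k :=
    Summable.of_norm_bounded (hr.mul_right H) fun k => by
      rw [norm_mul]
      exact mul_le_mul_of_nonneg_left (hfH k) (norm_nonneg _)
  refine ⟨∑' k, l k * f k, tendsto_iff_norm_sub_tendsto_zero.mpr ?_⟩
  have hz := (tendsto_tsum_norm_sub hsA hl hs ht).mul_const H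
  rw [zero_mul] at hz
  refine squeeze_zero (fun _ => norm_nonneg _) (fun n => ?_) hz
  have h1 : ∑ k ∈ Finset.range (n + 1), A n k * f k = ∑' k, A n k * f k :=
    (tsum_eq_sum fun k hk => by rw [hA n k (by simpa using hk), zero_mul]).symm
  rw [h1, ← (hmul (hsA n)).tsum_sub (hmul hs)]
  refine tsum_of_norm_bounded ((hsd n).hasSum.mul_right H) fun k => ?_
  rw [← sub_mul, norm_mul]
  exact mul_le_mul_of_nonneg_left (hfH k) (norm_nonneg _)

theorem omega_eq_zero (q γ : ℝ) (a : ℕ → ℂ) (n k : ℕ) (h : n < k) : omega q γ a n k = 0 :=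
  if_neg (not_le.mpr h)

end QDiff

/-! ### The three β-duals -/

open QDiff in
theorem theorem3 (q γ : ℝ) (hq0 : 0 < q) (hq1 : q < 1) (hγ : ∀ n : ℕ, γ ≠ -((n : ℝ) + 1)) :
    (∀ p : ℝ, 0 < p → p ≤ 1 →
      QDiff.betaDual (QDiff.nablaDomain q γ (QDiff.ell (ENNReal.ofReal p))) =
        QDiff.T1 q γ ∩ QDiff.T3 q γ p) ∧
    (∀ p p' : ℝ, 1 < p → 1 / p + 1 / p' = 1 →
      QDiff.betaDual (QDiff.nablaDomain q γ (QDiff.ell (ENNReal.ofReal p))) =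
        QDiff.T1 q γ ∩ QDiff.T2 q γ p') ∧
    QDiff.betaDual (QDiff.nablaDomain q γ (QDiff.ell ⊤)) =
      QDiff.T1 q γ ∩ QDiff.T4 q γ := by
  have hdual (X : Set (ℕ → ℂ)) (a : ℕ → ℂ) :
      a ∈ betaDual (nablaDomain q γ X) ↔ MapsToConvergent (omega q γ a) X :=
    mem_betaDual_nablaDomain_iff hq0 hq1 hγ X a
  refine ⟨fun p hp hp1 => ?_, fun p p' hp hpp => ?_, ?_⟩
  · ext a
    rw [hdual]
    have hA := omega_eq_zero q γ a
    constructor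
    · intro h
      refine ⟨h.column hA, ?_⟩
      obtain ⟨C, hC⟩ := h.exists_norm_le hA hp
      refine ⟨C ^ p, ?_⟩
      rintro _ ⟨⟨j, k⟩, rfl⟩
      exact Real.rpow_le_rpow (norm_nonneg _) (hC j k) hp.le
    · rintro ⟨h1, C, hC⟩
      have hb (n k : ℕ) : ‖omega q γ a n k‖ ≤ C ^ (1 / p) := by
        have h : ‖omega q γ a n k‖ ^ p ≤ C := hC ⟨(n, k), rfl⟩
        calc ‖omega q γ a n k‖ = (‖omega q γ a n k‖ ^ p) ^ (1 / p) := by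
              rw [one_div, Real.rpow_rpow_inv (norm_nonneg _) hp.ne']
          _ ≤ C ^ (1 / p) := Real.rpow_le_rpow (by positivity) h (by positivity)
      -- Since `ℓ_p ⊆ ℓ_1` for `p ≤ 1`, the sufficiency can be proved on `ℓ_1`.
      have h := mapsToConvergent_of_norm_rowFunctional_le hA ENNReal.one_ne_top
        (fun n => norm_rowFunctional_one_le (hb n)) h1
      exact fun f hf => h f (Memℓp.of_exponent_ge hf (by simpa using hp1))
  · have hc : p.HolderConjugate p' :=
      Real.holderConjugate_iff.mpr ⟨hp, by simpa only [one_div] using hpp⟩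
    have : Fact (1 ≤ ENNReal.ofReal p) := ⟨by simpa using hp.le⟩
    ext a
    rw [hdual]
    have hA := omega_eq_zero q γ a
    have htsum (n : ℕ) : ∑' k, ‖omega q γ a n k‖ ^ p' =
        ∑ k ∈ Finset.range (n + 1), ‖omega q γ a n k‖ ^ p' :=
      tsum_eq_sum fun k hk => by
        rw [hA n k (by simpa using hk), norm_zero, Real.zero_rpow hc.symm.ne_zero]
    constructor
    · intro h
      refine ⟨h.column hA, ?_⟩
      obtain ⟨C, hC⟩ := h.exists_norm_rowFunctional_le
      refine ⟨C ^ p', ?_⟩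
      rintro _ ⟨n, rfl⟩
      exact (htsum n).trans_le (sum_rpow_le_of_norm_rowFunctional_le hc (hC n))
    · rintro ⟨h1, C, hC⟩
      have hb (n : ℕ) : ∑ k ∈ Finset.range (n + 1), ‖omega q γ a n k‖ ^ p' ≤ C :=
        (htsum n).symm.trans_le (hC ⟨n, rfl⟩)
      have hC0 : 0 ≤ C := (Finset.sum_nonneg fun _ _ => by positivity).trans (hb 0)
      exact mapsToConvergent_of_norm_rowFunctional_le hA ENNReal.ofReal_ne_top
        (fun n => norm_rowFunctional_le_of_sum_rpow_le hc hC0 (hb n)) h1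
  · ext a
    rw [hdual]
    have hA := omega_eq_zero q γ a
    constructor
    · intro h
      have h1 := h.column hA
      refine ⟨h1, ?_⟩
      choose l hl using h1
      exact ⟨l, hl, h.summable_and_tendsto_tsum_norm hA hl⟩
    · rintro ⟨-, l, hl, hs, ht⟩
      exact mapsToConvergent_ell_top hA hl hs ht
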